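/- Let $\Gamma$ be a finite, simple, undirected, connected graph with vertex set $X$, path-length distance $\partial$ and diameter $D\ge 3$, and put $\Gamma_i(x)=\{y\in X:\partial(x,y)=i\}$. Assume that $\Gamma$ is distance-regular: for $0\le h,i,j\le D$ the number $p^h_{i,j}=|\Gamma_i(x)\cap\Gamma_j(y)|$ is the same for all $x,y\in X$ with $\partial(x,y)=h$. Assume that the valency $k=p^0_{1,1}$ is at least $3$. Write $a_i=p^i_{1,i}$, and assume that $\Gamma$ is bipartite ($a_i=0$ for $0\le i\le D$) or almost bipartite ($a_i=0$ for $0\le i\le D-1$ and $a_D\ne 0$). Let $V=\mathbb R^X$ with its standard basis $\{\hat x: x\in X\}$. Let $A_i$ be the $i$th distance matrix of $\Gamma$ (its $(x,y)$-entry is $1$ if $\partial(x,y)=i$ and $0$ otherwise), and let $M=\mathrm{Span}\{A_0,\dots,A_D\}$ be the Bose–Mesner algebra. An ordering of the primitive idempotents of $\Gamma$ is a basis $E_0,\dots,E_D$ of $M$ consisting of symmetric matrices such that $E_0=|X|^{-1}J$ (with $J$ the all-ones matrix), $\sum_{i=0}^D E_i=I$ and $E_iE_j=\delta_{i,j}E_i$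 for $0\le i,j\le D$. Its Krein parameters $q^h_{i,j}\in\mathbb R$ are defined by $E_i\circ E_j=|X|^{-1}\sum_{h=0}^D q^h_{i,j}E_h$, where $\circ$ is the entrywise product. The ordering is $Q$-polynomial if for all $0\le h,i,j\le D$ one has $q^h_{i,j}=0$ whenever one of $h,i,j$ is greater than the sum of the other two, and $q^h_{i,j}\neq 0$ whenever one of $h,i,j$ equals the sum of the other two. A $Q$-polynomial primitive idempotent is a matrix $E$ such that $E=E_1$ for some $Q$-polynomial ordering $E_0,\dots,E_D$. For such $E$ and for $u,v\in EV$, the Norton product is $u\star v=E(u\circ v)$, where $u\circ v$ is the entrywise product of vectors. Then for every $Q$-polynomial primitive idempotent $E$ of $\Gamma$ the set $\{E\hat x: x\in X\}$ is Norton-balanced; that is, for all $x,y\in X$ and all $0\le i,j\le D$, $$\sum_{z\in\Gamma_i(x)\cap\Gamma_j(y)}E\hat z\ \in\ \mathrm{Span}\{E\hat x,\ E\hat y,\ E\hat x\star E\hat y\}.$$ -/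

import Mathlib

namespace DRG

open scoped Matrix

noncomputable section

variable {X : Type*} [Fintype X] [DecidableEq X]

/-- `Γ_i(x)`, the set of vertices at distance `i` from `x`. -/
def sphere (G : SimpleGraph X) (i : ℕ) (x : X) : Finset X :=
  Finset.univ.filter fun y => G.dist x y = i

/-- `G` is distance-regular: it is connected, and for `0 ≤ h, i, j ≤ D` the cardinality of
`Γ_i(x) ∩ Γ_j(y)` is the same for all `x, y` at distance `h`. -/
def IsDistanceRegular (G : SimpleGraph X) : Prop :=
  G.Connected ∧
    ∀ h ≤ G.diam, ∀ i ≤ G.diam, ∀ j ≤ G.diam, ∀ x y x' y' : X,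
      G.dist x y = h → G.dist x' y' = h →
        (sphere G i x ∩ sphere G j y).card = (sphere G i x' ∩ sphere G j y').card

/-- The intersection number `p^h_{i,j}`, written as the maximum of `|Γ_i(x) ∩ Γ_j(y)|` over the
pairs at distance `h`; in a distance-regular graph all these cardinalities agree, see
`intersectionNumber_eq`. -/
def intersectionNumber (G : SimpleGraph X) (h i j : ℕ) : ℕ :=
  (Finset.univ.filter fun q : X × X => G.dist q.1 q.2 = h).sup
    fun q => (sphere G i q.1 ∩ sphere G j q.2).card

theorem intersectionNumber_eq {G : SimpleGraph X} (hG : IsDistanceRegular G) {h i j : ℕ}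
    (hh : h ≤ G.diam) (hi : i ≤ G.diam) (hj : j ≤ G.diam) {x y : X} (hxy : G.dist x y = h) :
    intersectionNumber G h i j = (sphere G i x ∩ sphere G j y).card := by
  apply le_antisymm
  · refine Finset.sup_le fun q hq => ?_
    exact (hG.2 h hh i hi j hj q.1 q.2 x y (by simpa using hq) hxy).le
  · exact Finset.le_sup (f := fun q : X × X => (sphere G i q.1 ∩ sphere G j q.2).card)
      (b := (x, y)) (by simpa using hxy)

/-- The intersection number `a_i = p^i_{1,i}`. -/
def a (G : SimpleGraph X) (i : ℕ) : ℕ := intersectionNumber G i 1 i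

/-- The valency `k = p^0_{1,1}`. -/
def valency (G : SimpleGraph X) : ℕ := intersectionNumber G 0 1 1

/-- `a_i = 0` for `0 ≤ i ≤ D`. -/
def IsBipartite (G : SimpleGraph X) : Prop := ∀ i ≤ G.diam, a G i = 0

/-- `a_i = 0` for `0 ≤ i ≤ D - 1`, and `a_D ≠ 0`. -/
def IsAlmostBipartite (G : SimpleGraph X) : Prop :=
  (∀ i < G.diam, a G i = 0) ∧ a G G.diam ≠ 0

/-- The `i`-th distance matrix `A_i`. -/
def distanceMatrix (G : SimpleGraph X) (i : ℕ) : Matrix X X ℝ :=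
  Matrix.of fun x y => if G.dist x y = i then 1 else 0

/-- The Bose-Mesner algebra `M`, as the linear span of `A_0, …, A_D`. -/
def boseMesner (G : SimpleGraph X) : Submodule ℝ (Matrix X X ℝ) :=
  Submodule.span ℝ (Set.range fun i : Fin (G.diam + 1) => distanceMatrix G i)

/-- `E_0, …, E_D` is an ordering of the primitive idempotents of `G`, starting with the trivial
one: a basis of the Bose-Mesner algebra, made of symmetric and mutually orthogonal idempotents
whose sum is the identity matrix, with `E_0 = |X|⁻¹ J`. -/
structure IsPrimitiveIdempotentOrdering (G : SimpleGraph X)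
    (E : Fin (G.diam + 1) → Matrix X X ℝ) : Prop where
  linearIndependent : LinearIndependent ℝ E
  span_eq : Submodule.span ℝ (Set.range E) = boseMesner G
  trivial_eq : E 0 = (Fintype.card X : ℝ)⁻¹ • Matrix.of fun _ _ => (1 : ℝ)
  sum_eq : ∑ i, E i = 1
  transpose_eq : ∀ i, (E i)ᵀ = E i
  mul_eq : ∀ i j, E i * E j = if i = j then E i else 0

/-- `q h i j = q^h_{i,j}` are the Krein parameters for the ordering `E`:
`E_i ∘ E_j = |X|⁻¹ ∑_h q^h_{i,j} E_h`, with the entrywise product on the left. For linearly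
independent `E_0, …, E_D` these equations determine `q`. -/
def IsKreinParameters {n : ℕ} (E : Fin n → Matrix X X ℝ) (q : Fin n → Fin n → Fin n → ℝ) : Prop :=
  ∀ i j, E i ⊙ E j = (Fintype.card X : ℝ)⁻¹ • ∑ h, q h i j • E h

/-- The ordering `E_0, …, E_D` of the primitive idempotents is `Q`-polynomial. -/
def IsQPolynomialOrdering (G : SimpleGraph X) (E : Fin (G.diam + 1) → Matrix X X ℝ) : Prop :=
  IsPrimitiveIdempotentOrdering G E ∧
    ∃ q : Fin (G.diam + 1) → Fin (G.diam + 1) → Fin (G.diam + 1) → ℝ,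
      IsKreinParameters E q ∧
      ∀ h i j : Fin (G.diam + 1),
        (((h : ℕ) > i + j ∨ (i : ℕ) > h + j ∨ (j : ℕ) > h + i) → q h i j = 0) ∧
        (((h : ℕ) = i + j ∨ (i : ℕ) = h + j ∨ (j : ℕ) = h + i) → q h i j ≠ 0)

/-- `E` is a `Q`-polynomial primitive idempotent of `G`: it is the term `E_1` of some
`Q`-polynomial ordering `E_0, …, E_D` of the primitive idempotents. -/
def IsQPolynomialIdempotent (G : SimpleGraph X) (E : Matrix X X ℝ) : Prop :=
  ∃ F : Fin (G.diam + 1) → Matrix X X ℝ, IsQPolynomialOrdering G F ∧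
    ∃ i : Fin (G.diam + 1), (i : ℕ) = 1 ∧ E = F i

/-- The vector `x̂`. -/
def hat (x : X) : X → ℝ := Pi.single x 1

/-- The Norton product `u ⋆ v = E (u ∘ v)`; it is used for `u, v` in the column space `E V`. -/
def nortonProduct (E : Matrix X X ℝ) (u v : X → ℝ) : X → ℝ :=
  E *ᵥ fun z => u z * v z

/-- The set `{E x̂ : x ∈ X}` is Norton-balanced. -/
def IsNortonBalanced (G : SimpleGraph X) (E : Matrix X X ℝ) : Prop :=
  ∀ x y : X, ∀ i ≤ G.diam, ∀ j ≤ G.diam,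
    ∑ z ∈ sphere G i x ∩ sphere G j y, E *ᵥ hat z ∈
      Submodule.span ℝ
        {E *ᵥ hat x, E *ᵥ hat y, nortonProduct E (E *ᵥ hat x) (E *ᵥ hat y)}

end

end DRG

/-!
For matrices `B, C` in the Bose-Mesner algebra `M` and vertices `y, z`, put
`T(B, C) = E (B ŷ ∘ C ẑ)`, which is bilinear in `B` and `C`. The vectors in the Norton-balanced
condition are `T(A_i, A_j)`, and `E ŷ ⋆ E ẑ = T(E, E)`, so it suffices to show that `T(B, C)` lies in
`W(y, z) = Span{E ŷ, E ẑ, E ŷ ⋆ E ẑ}` for all `B, C ∈ M`. Exchanging `B` with `C` and `y` with `z`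
changes neither `T(B, C)` nor `W(y, z)`.

The `Q`-polynomial property enters in two ways. First, `T(E_i, E_j) = 0` for `|i - j| > 1`, because
`E_1 (E_i ∘ E_j) E_1` is a multiple of `q^1_{i,j}` and is the Gram matrix of the functions
`(y, z) ↦ T(E_i, E_j)` (`mulVec_hadamard_eq_zero`). Second, the entries of `E = E_1` separate
the distances (`dist_eq_of_apply_eq`).

Clearly `T(B, I)` is a multiple of `E ẑ` and `T(E, E_0)` one of `E ŷ`. Writing `I = ∑ E_j`, the
vector `T(E, I)` becomes `T(E, E_0) + T(E, E) + T(E, E_2)`, whence `T(E, E_2) ∈ W`; writing the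
adjacency matrix as `A = ∑ θ_j E_j` gives `T(E, A) ∈ W`. Now (almost) bipartiteness is used: the
neighbours of `z` lie at no more than two distances from `y`, so on them every column `B ŷ` agrees
with a combination of `E ŷ` and a constant vector. Hence `T(B, A) ∈ W` for all `B ∈ M`
(`tripleProduct_adj_mem`).

Finally `T(E_i, E_j) ∈ W` by induction on `i` (`tripleProduct_idempotent_mem`). The terms with
`j < i` are covered by symmetry, the terms with `j > i + 1` vanish, and the remaining two are found
from `T(E_i, I)` and `T(E_i, A)`, since the eigenvalues `θ_i` and `θ_{i+1}` of `A` are different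
(`IsPrimitiveIdempotentOrdering.eigenvalue_injective`).
-/

namespace DRG

open scoped Matrix

variable {X : Type*} {G : SimpleGraph X}

/-! ### The Bose-Mesner algebra and the bilinear map `(B, C) ↦ E (B ŷ ∘ C ẑ)` -/

theorem distanceMatrix_mem_boseMesner {i : ℕ} (hi : i ≤ G.diam) :
    distanceMatrix G i ∈ boseMesner G :=
  Submodule.subset_span ⟨⟨i, Nat.lt_succ_of_le hi⟩, rfl⟩

theorem apply_eq_of_dist_eq {B : Matrix X X ℝ} (hB : B ∈ boseMesner G) {x y x' y' : X}
    (h : G.dist x y = G.dist x' y') : B x y = B x' y' := by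
  obtain ⟨c, rfl⟩ := (Submodule.mem_span_range_iff_exists_fun ℝ).mp hB
  simp [Matrix.sum_apply, distanceMatrix, h]

variable [Fintype X]

theorem mem_sphere {i : ℕ} {x y : X} : y ∈ sphere G i x ↔ G.dist x y = i := by
  simp [sphere]

/-- The vector `E (B ŷ ∘ C ẑ)`, as a bilinear function of the matrices `B` and `C`. -/
def tripleProduct (E : Matrix X X ℝ) (y z : X) :
    Matrix X X ℝ →ₗ[ℝ] Matrix X X ℝ →ₗ[ℝ] (X → ℝ) :=
  LinearMap.mk₂ ℝ (fun B C => E *ᵥ fun w => B w y * C w z)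
    (fun B B' C => by rw [← Matrix.mulVec_add]; congr 1; ext w; simp [add_mul])
    (fun c B C => by rw [← Matrix.mulVec_smul]; congr 1; ext w; simp [mul_assoc])
    (fun B C C' => by rw [← Matrix.mulVec_add]; congr 1; ext w; simp [mul_add])
    (fun c B C => by rw [← Matrix.mulVec_smul]; congr 1; ext w; simp [mul_left_comm])

theorem tripleProduct_apply (E B C : Matrix X X ℝ) (y z : X) :
    tripleProduct E y z B C = E *ᵥ fun w => B w y * C w z := rfl

theorem tripleProduct_comm (E B C : Matrix X X ℝ) (y z : X) :
    tripleProduct E y z B C = tripleProduct E z y C B := by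
  simp only [tripleProduct_apply, mul_comm]

/-- If `K = P N`, where the columns of `N` are the vectors `Q ŷ ∘ R ẑ`, then
`K Kᵀ = P (Q ∘ R) P` for symmetric idempotents `Q` and `R`; so if that matrix is zero, then so is
`K`. -/
theorem mulVec_hadamard_eq_zero {P Q R : Matrix X X ℝ} (hP : Pᵀ = P) (hQ : Qᵀ = Q) (hR : Rᵀ = R)
    (hQQ : Q * Q = Q) (hRR : R * R = R) (h : P * (Q ⊙ R) * P = 0) (y z : X) :
    (P *ᵥ fun w => Q w y * R w z) = 0 := by
  let N : Matrix X (X × X) ℝ := Matrix.of fun w p => Q w p.1 * R w p.2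
  have hN : N * Nᵀ = Q ⊙ R := by
    ext u v
    have hq : ∀ p, Q v p = Q p v := fun p => congrFun (congrFun hQ p) v
    have hr : ∀ p, R v p = R p v := fun p => congrFun (congrFun hR p) v
    have h1 : Q u v = ∑ p, Q u p * Q p v := by rw [← Matrix.mul_apply, hQQ]
    have h2 : R u v = ∑ p, R u p * R p v := by rw [← Matrix.mul_apply, hRR]
    rw [Matrix.hadamard_apply, h1, h2, Finset.sum_mul_sum, Matrix.mul_apply,
      Fintype.sum_prod_type]
    exact Finset.sum_congr rfl fun p _ => Finset.sum_congr rfl fun r _ => by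
      simp only [N, Matrix.of_apply, Matrix.transpose_apply, hq, hr]; ring
  have hK : (P * N) * (P * N)ᴴ = 0 := by
    rw [Matrix.conjTranspose_eq_transpose_of_trivial, Matrix.transpose_mul, hP, Matrix.mul_assoc,
      ← Matrix.mul_assoc N, hN, ← Matrix.mul_assoc, h]
  ext x
  exact congrFun (congrFun (Matrix.self_mul_conjTranspose_eq_zero.mp hK) x) (y, z)

/-! ### Distance matrices and the eigenvalues of the adjacency matrix -/

variable [DecidableEq X]

theorem IsDistanceRegular.dist_le_diam (hG : IsDistanceRegular G) (x y : X) :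
    G.dist x y ≤ G.diam := by
  have : Nonempty X := ⟨x⟩
  exact SimpleGraph.dist_le_diam (SimpleGraph.connected_iff_ediam_ne_top.mp hG.1)

theorem distanceMatrix_zero (hG : IsDistanceRegular G) : distanceMatrix G 0 = 1 := by
  ext x y
  simp [distanceMatrix, Matrix.one_apply, hG.1.dist_eq_zero_iff]

theorem distanceMatrix_mul_apply (i j : ℕ) (x y : X) :
    (distanceMatrix G i * distanceMatrix G j) x y
      = ((sphere G i x ∩ sphere G j y).card : ℝ) := by
  simp only [Matrix.mul_apply, distanceMatrix, Matrix.of_apply, ← ite_and, mul_ite, mul_one, mul_zero]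
  rw [Finset.sum_boole]
  congr 2
  ext w
  simp [mem_sphere, G.dist_comm (u := w), and_comm]

/-- The three-term recurrence for the distance matrices. -/
theorem distanceMatrix_one_mul (hG : IsDistanceRegular G) {h : ℕ} (hh : h + 2 ≤ G.diam) :
    distanceMatrix G 1 * distanceMatrix G (h + 1) =
      (intersectionNumber G h 1 (h + 1) : ℝ) • distanceMatrix G h
      + (intersectionNumber G (h + 1) 1 (h + 1) : ℝ) • distanceMatrix G (h + 1)
      + (intersectionNumber G (h + 2) 1 (h + 1) : ℝ) • distanceMatrix G (h + 2) := by
  ext x y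
  rw [distanceMatrix_mul_apply]
  simp only [Matrix.add_apply, Matrix.smul_apply, distanceMatrix, Matrix.of_apply, smul_eq_mul]
  by_cases h0 : G.dist x y = h
  · rw [intersectionNumber_eq hG (by omega) (by omega) (by omega) h0]
    simp [h0]
  by_cases h1 : G.dist x y = h + 1
  · rw [intersectionNumber_eq hG (by omega) (by omega) (by omega) h1]
    simp [h1]
  by_cases h2 : G.dist x y = h + 2
  · rw [intersectionNumber_eq hG (by omega) (by omega) (by omega) h2]
    simp [h2]
  · simp only [h0, h1, h2, if_false, mul_zero, add_zero, Nat.cast_eq_zero, Finset.card_eq_zero]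
    refine Finset.eq_empty_of_forall_notMem fun w hw => ?_
    simp only [Finset.mem_inter, mem_sphere] at hw
    have t1 := hG.1.dist_triangle (u := x) (v := w) (w := y)
    have t2 := hG.1.dist_triangle (u := w) (v := x) (w := y)
    rw [G.dist_comm (u := w) (v := x)] at t2
    rw [G.dist_comm (u := w) (v := y)] at t1 t2
    omega

theorem exists_dist_eq_one_of_dist_eq_succ (hG : IsDistanceRegular G) {h : ℕ} {x y : X}
    (hxy : G.dist x y = h + 1) : ∃ w, G.dist x w = 1 ∧ G.dist y w = h := by
  obtain ⟨p, hp⟩ := hG.1.exists_walk_length_eq_dist x y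
  cases p with
  | nil => simp at hxy
  | @cons _ w _ hadj q =>
    refine ⟨w, SimpleGraph.dist_eq_one_iff_adj.mpr hadj, ?_⟩
    have hle := SimpleGraph.dist_le q
    have t := hG.1.dist_triangle (u := x) (v := w) (w := y)
    rw [SimpleGraph.dist_eq_one_iff_adj.mpr hadj] at t
    rw [SimpleGraph.Walk.length_cons] at hp
    rw [G.dist_comm]
    omega

/-- The adjacency matrix generates the Bose-Mesner algebra. -/
theorem distanceMatrix_mem_adjoin (hG : IsDistanceRegular G) (h : ℕ) :
    distanceMatrix G h ∈ Algebra.adjoin ℝ {distanceMatrix G 1} := by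
  induction h using Nat.strong_induction_on with
  | _ h ih =>
  match h with
  | 0 => rw [distanceMatrix_zero hG]; exact one_mem _
  | 1 => exact Algebra.subset_adjoin rfl
  | h + 2 =>
    by_cases hex : ∃ x y, G.dist x y = h + 2
    · obtain ⟨x, y, hxy⟩ := hex
      have hh : h + 2 ≤ G.diam := hxy ▸ hG.dist_le_diam x y
      have hc : (intersectionNumber G (h + 2) 1 (h + 1) : ℝ) ≠ 0 := by
        rw [intersectionNumber_eq hG hh (by omega) (by omega) hxy, Nat.cast_ne_zero,
          Finset.card_ne_zero]
        obtain ⟨w, h1, h2⟩ := exists_dist_eq_one_of_dist_eq_succ hG hxy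
        exact ⟨w, by simp [mem_sphere, h1, h2]⟩
      rw [← Subalgebra.mem_toSubmodule, ← Submodule.smul_mem_iff _ hc,
        ← add_sub_cancel_left
          ((intersectionNumber G h 1 (h + 1) : ℝ) • distanceMatrix G h
            + (intersectionNumber G (h + 1) 1 (h + 1) : ℝ) • distanceMatrix G (h + 1))
          ((intersectionNumber G (h + 2) 1 (h + 1) : ℝ) • distanceMatrix G (h + 2)),
        ← distanceMatrix_one_mul hG hh]
      exact Submodule.sub_mem _
        (mul_mem (S := Subalgebra ℝ (Matrix X X ℝ)) (Algebra.subset_adjoin rfl) (ih _ (by omega)))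
        (Submodule.add_mem _ (Subalgebra.smul_mem _ (ih _ (by omega)) _)
          (Subalgebra.smul_mem _ (ih _ (by omega)) _))
    · push Not at hex
      have : distanceMatrix G (h + 2) = 0 := by
        ext x y
        simp [distanceMatrix, hex x y]
      rw [this]
      exact zero_mem _

theorem boseMesner_le_adjoin (hG : IsDistanceRegular G) :
    boseMesner G ≤ (Algebra.adjoin ℝ {distanceMatrix G 1}).toSubmodule :=
  Submodule.span_le.mpr <| by rintro _ ⟨i, rfl⟩; exact distanceMatrix_mem_adjoin hG i

variable {F : Fin (G.diam + 1) → Matrix X X ℝ}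

theorem IsPrimitiveIdempotentOrdering.mem_boseMesner (hF : IsPrimitiveIdempotentOrdering G F)
    (i : Fin (G.diam + 1)) : F i ∈ boseMesner G :=
  hF.span_eq ▸ Submodule.subset_span ⟨i, rfl⟩

/-- The adjacency matrix has pairwise different eigenvalues on the eigenspaces of the primitive
idempotents, as it generates an algebra that contains all of these. -/
theorem IsPrimitiveIdempotentOrdering.eigenvalue_injective (hG : IsDistanceRegular G)
    (hF : IsPrimitiveIdempotentOrdering G F) {θ : Fin (G.diam + 1) → ℝ}
    (hθ : ∑ l, θ l • F l = distanceMatrix G 1) : Function.Injective θ := by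
  intro i j hij
  by_contra hne
  have hmul : ∀ l, distanceMatrix G 1 * F l = θ l • F l := fun l => by
    simp [← hθ, Finset.sum_mul, hF.mul_eq]
  have key : ∀ B ∈ Algebra.adjoin ℝ {distanceMatrix G 1},
      ∃ c : ℝ, B * F i = c • F i ∧ B * F j = c • F j := fun B hB => by
    induction hB using Algebra.adjoin_induction with
    | mem B hB =>
      obtain rfl : B = distanceMatrix G 1 := hB
      exact ⟨θ i, hmul i, hij ▸ hmul j⟩
    | algebraMap r =>
      exact ⟨r, by simp [Algebra.algebraMap_eq_smul_one], by simp [Algebra.algebraMap_eq_smul_one]⟩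
    | add B C _ _ hB hC =>
      obtain ⟨b, hb1, hb2⟩ := hB
      obtain ⟨c, hc1, hc2⟩ := hC
      exact ⟨b + c, by rw [add_mul, hb1, hc1, add_smul], by rw [add_mul, hb2, hc2, add_smul]⟩
    | mul B C _ _ hB hC =>
      obtain ⟨b, hb1, hb2⟩ := hB
      obtain ⟨c, hc1, hc2⟩ := hC
      exact ⟨c * b, by rw [mul_assoc, hc1, Matrix.mul_smul, hb1, smul_smul],
        by rw [mul_assoc, hc2, Matrix.mul_smul, hb2, smul_smul]⟩
  obtain ⟨c, h1, h2⟩ := key _ (boseMesner_le_adjoin hG (hF.mem_boseMesner i))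
  rw [hF.mul_eq, if_neg hne] at h2
  rw [hF.mul_eq, if_pos rfl] at h1
  rcases smul_eq_zero.mp h2.symm with hc | hFj
  · rw [hc, zero_smul] at h1
    exact hF.linearIndependent.ne_zero i h1
  · exact hF.linearIndependent.ne_zero j hFj

/-! ### Consequences of the `Q`-polynomial property -/

/-- The entries of a `Q`-polynomial primitive idempotent separate the distances: by the recurrence
`E_1 ∘ E_h ∈ Span{E_{h-1}, E_h, E_{h+1}}`, in which the coefficient of `E_{h+1}` is not zero, a
coincidence of entries of `E_1` carries over to `E_2, E_3, …` and so to the whole Bose-Mesner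
algebra. -/
theorem dist_eq_of_apply_eq (hG : IsDistanceRegular G) (hF : IsQPolynomialOrdering G F)
    {i : Fin (G.diam + 1)} (hi : (i : ℕ) = 1) {x y x' y' : X} (h : F i x y = F i x' y') :
    G.dist x y = G.dist x' y' := by
  obtain ⟨hP, q, hq, hQ⟩ := hF
  have hX : (Fintype.card X : ℝ)⁻¹ ≠ 0 :=
    inv_ne_zero (Nat.cast_ne_zero.mpr (Fintype.card_pos_iff.mpr ⟨x⟩).ne')
  have key : ∀ n (hn : n < G.diam + 1), F ⟨n, hn⟩ x y = F ⟨n, hn⟩ x' y' := by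
    intro n
    induction n using Nat.strong_induction_on with
    | _ n ih =>
    intro hn
    match n with
    | 0 =>
      have h0 := hP.trivial_eq
      change F ⟨0, hn⟩ = _ at h0
      rw [h0]
      rfl
    | 1 => rwa [show (⟨1, hn⟩ : Fin (G.diam + 1)) = i from Fin.ext hi.symm]
    | n + 2 =>
      set m : Fin (G.diam + 1) := ⟨n + 1, by omega⟩ with hm
      set t : Fin (G.diam + 1) := ⟨n + 2, hn⟩ with ht
      have hqt : q t i m ≠ 0 := (hQ t i m).2 (Or.inl (by simp [hm, ht, hi]; omega))
      have hentry : ∀ u v, F i u v * F m u v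
          = (Fintype.card X : ℝ)⁻¹ * (q t i m * F t u v
            + ∑ l ∈ Finset.univ.erase t, q l i m * F l u v) := fun u v => by
        have := congrFun (congrFun (hq i m) u) v
        rw [Matrix.hadamard_apply, Matrix.smul_apply, Matrix.sum_apply, smul_eq_mul] at this
        rw [this, Finset.add_sum_erase _ (fun l => q l i m * F l u v) (Finset.mem_univ t)]
        simp
      have hrest : ∑ l ∈ Finset.univ.erase t, q l i m * F l x y
          = ∑ l ∈ Finset.univ.erase t, q l i m * F l x' y' := by
        refine Finset.sum_congr rfl fun l hl => ?_
        rcases lt_or_ge (l : ℕ) (n + 2) with hlt | hge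
        · rw [ih l hlt l.2]
        · have hne : (l : ℕ) ≠ n + 2 := fun h => Finset.ne_of_mem_erase hl (Fin.ext h)
          rw [(hQ l i m).1 (Or.inl (by simp [hm, hi]; omega)), zero_mul, zero_mul]
      have e1 := hentry x y
      have hm' : F m x y = F m x' y' := ih (n + 1) (by omega) _
      rw [h, hm', hentry x' y', hrest] at e1
      have e2 := add_right_cancel (mul_left_cancel₀ hX e1)
      exact (mul_left_cancel₀ hqt e2).symm
  have hmem : distanceMatrix G (G.dist x y) ∈ Submodule.span ℝ (Set.range F) :=
    hP.span_eq ▸ distanceMatrix_mem_boseMesner (hG.dist_le_diam x y)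
  obtain ⟨c, hc⟩ := (Submodule.mem_span_range_iff_exists_fun ℝ).mp hmem
  have : distanceMatrix G (G.dist x y) x y = distanceMatrix G (G.dist x y) x' y' := by
    simp only [← hc, Matrix.sum_apply, Matrix.smul_apply]
    exact Finset.sum_congr rfl fun l _ => by rw [key l l.2]
  by_contra hne
  simp [distanceMatrix, Ne.symm hne] at this

theorem idempotent_mul_hadamard_eq_zero (hF : IsPrimitiveIdempotentOrdering G F)
    {q : Fin (G.diam + 1) → Fin (G.diam + 1) → Fin (G.diam + 1) → ℝ} (hq : IsKreinParameters F q)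
    {h i j : Fin (G.diam + 1)} (h0 : q h i j = 0) : F h * (F i ⊙ F j) * F h = 0 := by
  rw [hq i j, Matrix.mul_smul, Matrix.smul_mul, Finset.mul_sum, Finset.sum_mul]
  refine smul_eq_zero_of_right _ (Finset.sum_eq_zero fun l _ => ?_)
  rw [Matrix.mul_smul, Matrix.smul_mul, hF.mul_eq]
  by_cases hl : h = l
  · rw [← hl, h0, zero_smul]
  · rw [if_neg hl, zero_mul, smul_zero]

/-! ### The span of `E ŷ`, `E ẑ` and `E ŷ ⋆ E ẑ` -/

theorem mulVec_hat (E : Matrix X X ℝ) (x : X) : E *ᵥ hat x = fun w => E w x := by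
  ext w
  simp [hat]

/-- The span of `E ŷ`, `E ẑ` and `E ŷ ⋆ E ẑ`. -/
def nortonSpan (E : Matrix X X ℝ) (y z : X) : Submodule ℝ (X → ℝ) :=
  Submodule.span ℝ {E *ᵥ hat y, E *ᵥ hat z, nortonProduct E (E *ᵥ hat y) (E *ᵥ hat z)}

theorem mulVec_hat_right_mem (E : Matrix X X ℝ) (y z : X) : E *ᵥ hat z ∈ nortonSpan E y z :=
  Submodule.subset_span (by simp)

theorem tripleProduct_self_mem (E : Matrix X X ℝ) (y z : X) :
    tripleProduct E y z E E ∈ nortonSpan E y z :=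
  Submodule.subset_span (by simp [tripleProduct_apply, nortonProduct, mulVec_hat])

theorem nortonSpan_comm (E : Matrix X X ℝ) (y z : X) : nortonSpan E y z = nortonSpan E z y := by
  have : nortonProduct E (E *ᵥ hat y) (E *ᵥ hat z) = nortonProduct E (E *ᵥ hat z) (E *ᵥ hat y) := by
    simp only [nortonProduct, mul_comm]
  rw [nortonSpan, nortonSpan, this, Set.insert_comm]

theorem tripleProduct_mem_comm {E B C : Matrix X X ℝ} {y z : X} :
    tripleProduct E y z B C ∈ nortonSpan E y z ↔ tripleProduct E z y C B ∈ nortonSpan E z y := by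
  rw [tripleProduct_comm, nortonSpan_comm]

theorem tripleProduct_one_right_mem (E B : Matrix X X ℝ) (y z : X) :
    tripleProduct E y z B 1 ∈ nortonSpan E y z := by
  have : (fun w => B w y * (1 : Matrix X X ℝ) w z) = B z y • hat z := by
    ext w
    by_cases hw : w = z
    · simp [hw, hat, Matrix.one_apply]
    · simp [hw, hat]
  rw [tripleProduct_apply, this, Matrix.mulVec_smul]
  exact Submodule.smul_mem _ _ (mulVec_hat_right_mem E y z)

/-- `E (1 ∘ C ẑ)` is a multiple of `E ẑ`, as `E C` is a multiple of `E`. -/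
theorem tripleProduct_const_left_mem (hF : IsPrimitiveIdempotentOrdering G F)
    (i : Fin (G.diam + 1)) {C : Matrix X X ℝ} (hC : C ∈ boseMesner G) (y z : X) :
    tripleProduct (F i) y z (Matrix.of fun _ _ => 1) C ∈ nortonSpan (F i) y z := by
  rw [← hF.span_eq] at hC
  obtain ⟨c, rfl⟩ := (Submodule.mem_span_range_iff_exists_fun ℝ).mp hC
  have h1 : F i * ∑ l, c l • F l = c i • F i := by
    simp [Finset.mul_sum, hF.mul_eq]
  have h2 : tripleProduct (F i) y z (Matrix.of fun _ _ => 1) (∑ l, c l • F l)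
      = (F i * ∑ l, c l • F l) *ᵥ hat z := by
    rw [← Matrix.mulVec_mulVec, mulVec_hat, tripleProduct_apply]
    simp
  rw [h2, h1, Matrix.smul_mulVec]
  exact Submodule.smul_mem _ _ (mulVec_hat_right_mem _ y z)

theorem tripleProduct_eq_zero (hF : IsPrimitiveIdempotentOrdering G F)
    {q : Fin (G.diam + 1) → Fin (G.diam + 1) → Fin (G.diam + 1) → ℝ} (hq : IsKreinParameters F q)
    {h i j : Fin (G.diam + 1)} (h0 : q h i j = 0) (y z : X) :
    tripleProduct (F h) y z (F i) (F j) = 0 :=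
  mulVec_hadamard_eq_zero (hF.transpose_eq h) (hF.transpose_eq i) (hF.transpose_eq j)
    (by simp [hF.mul_eq]) (by simp [hF.mul_eq]) (idempotent_mul_hadamard_eq_zero hF hq h0) y z

/-! ### Bipartite and almost bipartite graphs -/

theorem dist_ne_of_a_eq_zero (hG : IsDistanceRegular G) (hD : 1 ≤ G.diam) {y z w : X}
    (ha : a G (G.dist z y) = 0) (hw : G.dist z w = 1) : G.dist y w ≠ G.dist z y := by
  intro h
  have hle := hG.dist_le_diam z y
  rw [a, intersectionNumber_eq hG hle hD hle rfl, Finset.card_eq_zero] at ha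
  have : w ∈ sphere G 1 z ∩ sphere G (G.dist z y) y := by simp [mem_sphere, hw, h]
  simp [ha] at this

/-- The neighbours of `z` lie at no more than two distances from `y`. -/
theorem dist_pigeonhole (hG : IsDistanceRegular G) (hD : 1 ≤ G.diam)
    (hB : IsBipartite G ∨ IsAlmostBipartite G) {y z u v w : X} (hu : G.dist z u = 1)
    (hv : G.dist z v = 1) (hw : G.dist z w = 1) (huv : G.dist u y ≠ G.dist v y) :
    G.dist w y = G.dist u y ∨ G.dist w y = G.dist v y := by
  have near : ∀ t, G.dist z t = 1 →
      G.dist t y ≤ G.dist z y + 1 ∧ G.dist z y ≤ G.dist t y + 1 ∧ G.dist t y ≤ G.diam := by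
    intro t ht
    have t1 := hG.1.dist_triangle (u := t) (v := z) (w := y)
    have t2 := hG.1.dist_triangle (u := z) (v := t) (w := y)
    rw [G.dist_comm (u := t) (v := z)] at t1
    exact ⟨by omega, by omega, hG.dist_le_diam t y⟩
  have nu := near u hu
  have nv := near v hv
  have nw := near w hw
  have hle := hG.dist_le_diam z y
  by_cases ha : a G (G.dist z y) = 0
  · have au := dist_ne_of_a_eq_zero hG hD ha hu
    have av := dist_ne_of_a_eq_zero hG hD ha hv
    have aw := dist_ne_of_a_eq_zero hG hD ha hw
    rw [G.dist_comm] at au av aw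
    omega
  · -- here `z` is at distance `D` from `y`, so there are no neighbours further away
    have hzy : G.dist z y = G.diam := by
      rcases hB with hB | hB
      · exact absurd (hB _ hle) ha
      · by_contra hne
        exact ha (hB.1 _ (lt_of_le_of_ne hle hne))
    omega

/-- On the neighbours of `z`, every column of a matrix in the Bose-Mesner algebra is a combination of
the same column of `E_1` and a constant vector. -/
theorem exists_apply_eq_on_neighbors (hG : IsDistanceRegular G) (hD : 1 ≤ G.diam)
    (hB : IsBipartite G ∨ IsAlmostBipartite G) (hF : IsQPolynomialOrdering G F)
    {i : Fin (G.diam + 1)} (hi : (i : ℕ) = 1) {B : Matrix X X ℝ} (hBM : B ∈ boseMesner G)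
    (y z : X) : ∃ c d : ℝ, ∀ w, G.dist z w = 1 → B w y = c * F i w y + d := by
  by_cases hex : ∃ u v, G.dist z u = 1 ∧ G.dist z v = 1 ∧ G.dist u y ≠ G.dist v y
  · obtain ⟨u, v, hu, hv, huv⟩ := hex
    have hne : F i u y - F i v y ≠ 0 :=
      sub_ne_zero.mpr fun h => huv (dist_eq_of_apply_eq hG hF hi h)
    -- interpolate at the two distances that occur
    set c := (B u y - B v y) / (F i u y - F i v y) with hc
    have hcm : c * (F i u y - F i v y) = B u y - B v y := div_mul_cancel₀ _ hne
    clear_value c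
    refine ⟨c, B u y - c * F i u y, fun w hw => ?_⟩
    rcases dist_pigeonhole hG hD hB hu hv hw huv with h | h
    · rw [apply_eq_of_dist_eq hBM h, apply_eq_of_dist_eq (hF.1.mem_boseMesner i) h]
      ring
    · rw [apply_eq_of_dist_eq hBM h, apply_eq_of_dist_eq (hF.1.mem_boseMesner i) h]
      linear_combination hcm
  · push Not at hex
    by_cases hu : ∃ u, G.dist z u = 1
    · obtain ⟨u, hu⟩ := hu
      refine ⟨0, B u y, fun w hw => ?_⟩
      rw [apply_eq_of_dist_eq hBM (hex w u hw hu)]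
      ring
    · exact ⟨0, 0, fun w hw => absurd ⟨w, hw⟩ hu⟩

variable {i : Fin (G.diam + 1)}

theorem tripleProduct_zero_right_mem (hF : IsPrimitiveIdempotentOrdering G F) (y z : X) :
    tripleProduct (F i) y z (F i) (F 0) ∈ nortonSpan (F i) y z := by
  rw [hF.trivial_eq, map_smul]
  exact Submodule.smul_mem _ _ (tripleProduct_mem_comm.mp
    (tripleProduct_const_left_mem hF i (hF.mem_boseMesner i) z y))

theorem mem_of_sum_mem {ι V : Type*} [Fintype ι] [DecidableEq ι] [AddCommGroup V] [Module ℝ V]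
    {W : Submodule ℝ V} {v : ι → V} (hsum : ∑ j, v j ∈ W) (b : ι) (hv : ∀ j ≠ b, v j ∈ W) :
    v b ∈ W := by
  rw [← Finset.add_sum_erase _ _ (Finset.mem_univ b)] at hsum
  exact (Submodule.add_mem_iff_left _
    (Submodule.sum_mem _ fun j hj => hv j (Finset.ne_of_mem_erase hj))).mp hsum

theorem sum_tripleProduct_mem (hF : IsPrimitiveIdempotentOrdering G F) (E B : Matrix X X ℝ)
    (y z : X) : ∑ j, tripleProduct E y z B (F j) ∈ nortonSpan E y z := by
  rw [← map_sum, hF.sum_eq]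
  exact tripleProduct_one_right_mem E B y z

theorem tripleProduct_self_adj_mem (hD : 1 ≤ G.diam) (hF : IsQPolynomialOrdering G F)
    (hi : (i : ℕ) = 1) (y z : X) :
    tripleProduct (F i) y z (F i) (distanceMatrix G 1) ∈ nortonSpan (F i) y z := by
  obtain ⟨hP, q, hq, hQ⟩ := hF
  have hmem : distanceMatrix G 1 ∈ Submodule.span ℝ (Set.range F) :=
    hP.span_eq ▸ distanceMatrix_mem_boseMesner hD
  obtain ⟨θ, hθ⟩ := (Submodule.mem_span_range_iff_exists_fun ℝ).mp hmem
  have hne : ∀ j : Fin (G.diam + 1), (j : ℕ) ≠ 2 →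
      tripleProduct (F i) y z (F i) (F j) ∈ nortonSpan (F i) y z := by
    intro j hj
    by_cases h0 : (j : ℕ) = 0
    · obtain rfl : j = 0 := Fin.ext h0
      exact tripleProduct_zero_right_mem hP y z
    by_cases h1 : (j : ℕ) = 1
    · obtain rfl : j = i := Fin.ext (h1.trans hi.symm)
      exact tripleProduct_self_mem _ y z
    · rw [tripleProduct_eq_zero hP hq ((hQ i i j).1 (Or.inr (Or.inr (by omega)))) y z]
      exact Submodule.zero_mem _
  have hall : ∀ j, tripleProduct (F i) y z (F i) (F j) ∈ nortonSpan (F i) y z := by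
    intro j
    by_cases hj : (j : ℕ) = 2
    · exact mem_of_sum_mem (sum_tripleProduct_mem hP (F i) (F i) y z) j
        fun l hl => hne l fun h => hl (Fin.ext (h.trans hj.symm))
    · exact hne j hj
  rw [← hθ, map_sum]
  exact Submodule.sum_mem _ fun j _ => by
    rw [map_smul]
    exact Submodule.smul_mem _ _ (hall j)

/-- `B ŷ ∘ A ẑ` is supported on the neighbours of `z`, where `B ŷ` is a combination of `E ŷ` and a
constant vector. -/
theorem tripleProduct_adj_mem (hG : IsDistanceRegular G) (hD : 1 ≤ G.diam)
    (hB : IsBipartite G ∨ IsAlmostBipartite G) (hF : IsQPolynomialOrdering G F)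
    (hi : (i : ℕ) = 1) {B : Matrix X X ℝ} (hBM : B ∈ boseMesner G) (y z : X) :
    tripleProduct (F i) y z B (distanceMatrix G 1) ∈ nortonSpan (F i) y z := by
  obtain ⟨c, d, hcd⟩ := exists_apply_eq_on_neighbors hG hD hB hF hi hBM y z
  have h : tripleProduct (F i) y z B (distanceMatrix G 1)
      = tripleProduct (F i) y z (c • F i + d • Matrix.of fun _ _ => 1) (distanceMatrix G 1) := by
    simp only [tripleProduct_apply]
    congr 1
    ext w
    by_cases hw : G.dist z w = 1
    · rw [hcd w hw]
      simp
    · simp [distanceMatrix, G.dist_comm (u := w), hw]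
  rw [h, map_add, map_smul, map_smul]
  exact Submodule.add_mem _
    (Submodule.smul_mem _ _ (tripleProduct_self_adj_mem hD hF hi y z))
    (Submodule.smul_mem _ _
      (tripleProduct_const_left_mem hF.1 i (distanceMatrix_mem_boseMesner hD) y z))

theorem tripleProduct_idempotent_mem (hG : IsDistanceRegular G) (hD : 1 ≤ G.diam)
    (hB : IsBipartite G ∨ IsAlmostBipartite G) (hF : IsQPolynomialOrdering G F)
    (hi : (i : ℕ) = 1) (l j : Fin (G.diam + 1)) (y z : X) :
    tripleProduct (F i) y z (F l) (F j) ∈ nortonSpan (F i) y z := by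
  have hmem : distanceMatrix G 1 ∈ Submodule.span ℝ (Set.range F) :=
    hF.1.span_eq ▸ distanceMatrix_mem_boseMesner hD
  obtain ⟨θ, hθ⟩ := (Submodule.mem_span_range_iff_exists_fun ℝ).mp hmem
  have hθi := hF.1.eigenvalue_injective hG hθ
  obtain ⟨q, hq, hQ⟩ := hF.2
  induction l using WellFoundedLT.induction generalizing j y z with
  | _ l ih =>
  have hne : ∀ j : Fin (G.diam + 1), (j : ℕ) ≠ l → (j : ℕ) ≠ l + 1 →
      tripleProduct (F i) y z (F l) (F j) ∈ nortonSpan (F i) y z := by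
    intro j h0 h1
    rcases lt_or_ge j l with h | h
    · exact tripleProduct_mem_comm.mpr (ih j h l z y)
    · rw [tripleProduct_eq_zero hF.1 hq ((hQ i l j).1 (Or.inr (Or.inr (by omega)))) y z]
      exact Submodule.zero_mem _
  have hsum := sum_tripleProduct_mem hF.1 (F i) (F l) y z
  -- in `T(E_l, A) - θ_l T(E_l, I)` the term with index `l` cancels
  have hsum' : ∑ j, (θ j - θ l) • tripleProduct (F i) y z (F l) (F j) ∈ nortonSpan (F i) y z := by
    have hadj := tripleProduct_adj_mem hG hD hB hF hi (hF.1.mem_boseMesner l) y z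
    simp only [← hθ, map_sum, map_smul] at hadj
    simp only [sub_smul, Finset.sum_sub_distrib, ← Finset.smul_sum]
    exact Submodule.sub_mem _ hadj (Submodule.smul_mem _ _ hsum)
  have hne' : ∀ j ≠ l, tripleProduct (F i) y z (F l) (F j) ∈ nortonSpan (F i) y z := by
    intro j hj
    by_cases hj1 : (j : ℕ) = l + 1
    · refine (Submodule.smul_mem_iff _ (sub_ne_zero.mpr (hθi.ne hj))).mp
        (mem_of_sum_mem hsum' j fun k hk => ?_)
      by_cases hkl : k = l
      · rw [hkl, sub_self, zero_smul]
        exact Submodule.zero_mem _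
      · exact Submodule.smul_mem _ _
          (hne k (fun h => hkl (Fin.ext h)) fun h => hk (Fin.ext (h.trans hj1.symm)))
    · exact hne j (fun h => hj (Fin.ext h)) hj1
  by_cases hj : j = l
  · exact hj ▸ mem_of_sum_mem hsum l hne'
  · exact hne' j hj

theorem tripleProduct_mem (hG : IsDistanceRegular G) (hD : 1 ≤ G.diam)
    (hB : IsBipartite G ∨ IsAlmostBipartite G) (hF : IsQPolynomialOrdering G F)
    (hi : (i : ℕ) = 1) {B C : Matrix X X ℝ} (hBM : B ∈ boseMesner G) (hCM : C ∈ boseMesner G)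
    (y z : X) : tripleProduct (F i) y z B C ∈ nortonSpan (F i) y z := by
  rw [← hF.1.span_eq] at hBM hCM
  obtain ⟨b, rfl⟩ := (Submodule.mem_span_range_iff_exists_fun ℝ).mp hBM
  obtain ⟨c, rfl⟩ := (Submodule.mem_span_range_iff_exists_fun ℝ).mp hCM
  simp only [map_sum, map_smul, LinearMap.sum_apply, LinearMap.smul_apply]
  exact Submodule.sum_mem _ fun l _ => Submodule.smul_mem _ _ <| Submodule.sum_mem _ fun j _ =>
    Submodule.smul_mem _ _ (tripleProduct_idempotent_mem hG hD hB hF hi _ _ y z)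

/-- The sums in the Norton-balanced condition are values of `tripleProduct`. -/
theorem sum_mulVec_hat_eq (E : Matrix X X ℝ) (i j : ℕ) (x y : X) :
    ∑ z ∈ sphere G i x ∩ sphere G j y, E *ᵥ hat z
      = tripleProduct E x y (distanceMatrix G i) (distanceMatrix G j) := by
  rw [← Matrix.mulVec_sum, tripleProduct_apply]
  congr 1
  ext w
  simp only [Finset.sum_apply, hat, Pi.single_apply, Finset.sum_ite_eq, Finset.mem_inter,
    mem_sphere, distanceMatrix, Matrix.of_apply, G.dist_comm (u := w), ite_and, mul_ite, mul_one,
    mul_zero]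
  split_ifs <;> rfl

end DRG

theorem mainTheorem2 {X : Type*} [Fintype X] [DecidableEq X] (G : SimpleGraph X)
    (hG : DRG.IsDistanceRegular G) (hD : 3 ≤ G.diam) (hk : 3 ≤ DRG.valency G)
    (hB : DRG.IsBipartite G ∨ DRG.IsAlmostBipartite G)
    (E : Matrix X X ℝ) (hE : DRG.IsQPolynomialIdempotent G E) :
    DRG.IsNortonBalanced G E := by
  obtain ⟨F, hF, l, hl, rfl⟩ := hE
  intro x y i hi j hj
  rw [DRG.sum_mulVec_hat_eq]
  exact DRG.tripleProduct_mem hG (by omega) hB hF hl (DRG.distanceMatrix_mem_boseMesner hi)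
    (DRG.distanceMatrix_mem_boseMesner hj) x y
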